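/- All groups are commutative. A topological group is Polish if its underlying space is Polish, and analytic if its underlying space is metrizable and a continuous image of a Polish space. A group $G$ has no torsion (resp. is divisible) if for every integer $n\ge 1$ and every $a\in G$ the equation $nx=a$ has at most one (resp. at least one) solution $x\in G$. For $k=1,2,3,\dots$ let $H_k$ be the group $\mathbb R$ with the norm $$|x|_k=\sqrt{(\cos(\pi x)-1)^2+\sin^2(\pi x)+(2^{-(k+1)}x)^2},$$ equip the direct sum $\bigoplus_{k\ge 1}H_k$ with the norm $|(x_k)_k|=\sum_{k\ge 1}|x_k|_k$, and let $H$ be the completion of this direct sum with respect to this norm. Then $H$ is a Polish topological group without torsion, and the map $\frac12:2H\to H$, which sends each $x\in 2H=\{2y:y\in H\}$ to the unique $y\in H$ with $2y=x$, is discontinuous, where $2H$ carries the subspace topology. Moreover, $H$ is not isomorphic, as a topological group, to a (topological) subgroup of any divisible analytic group with no torsion. -/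

import Mathlib

namespace WoundGroup

/-- A topological space is analytic if it is metrizable and a continuous image of a Polish
space. -/
def IsAnalyticSpace (X : Type*) [TopologicalSpace X] : Prop :=
  TopologicalSpace.MetrizableSpace X ∧ MeasureTheory.AnalyticSet (Set.univ : Set X)

/-- Every equation `n • x = a` with `n` a positive integer has a solution. -/
def IsDivisible (G : Type*) [AddCommGroup G] : Prop :=
  ∀ n : ℕ, 0 < n → ∀ a : G, ∃ x : G, n • x = a

/-- The subgroup `nH = {n • y : y ∈ H}` of `H`. -/
def multiples (H : Type*) [AddCommGroup H] (n : ℕ) : AddSubgroup H :=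
  (nsmulAddMonoidHom n : H →+ H).range

/-- The map `1/n : nH → H`, sending `x` to an element `y` with `n • y = x`; this `y` is unique
when `n > 0` and `H` has no torsion. -/
noncomputable def divMap (H : Type*) [AddCommGroup H] (n : ℕ) (x : multiples H n) : H :=
  Classical.choose (AddMonoidHom.mem_range.1 x.2)

theorem nsmul_divMap (H : Type*) [AddCommGroup H] (n : ℕ) (x : multiples H n) :
    n • divMap H n x = (x : H) :=
  Classical.choose_spec (AddMonoidHom.mem_range.1 x.2)

theorem divMap_eq_iff (H : Type*) [AddCommGroup H] [IsAddTorsionFree H] (n : ℕ) (hn : 0 < n)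
    (x : multiples H n) (y : H) : divMap H n x = y ↔ n • y = (x : H) := by
  constructor
  · rintro rfl
    exact nsmul_divMap H n x
  · intro h
    apply IsAddTorsionFree.nsmul_right_injective hn.ne'
    change n • divMap H n x = n • y
    rw [nsmul_divMap, h]

/-- The distance from the origin to the image of `x` when the line is wound around a cylinder in
three-dimensional Euclidean space. -/
noncomputable def woundFun (k : ℕ+) (x : ℝ) : ℝ :=
  Real.sqrt ((Real.cos (Real.pi * x) - 1) ^ 2 + Real.sin (Real.pi * x) ^ 2
    + (x / 2 ^ ((k : ℕ) + 1)) ^ 2)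

theorem woundFun_eq (k : ℕ+) (x : ℝ) :
    woundFun k x = Real.sqrt ((2 * |Real.sin (Real.pi * x / 2)|) ^ 2
      + |x / 2 ^ ((k : ℕ) + 1)| ^ 2) := by
  unfold woundFun
  congr 1
  have h1 : Real.cos (Real.pi * x) = 2 * Real.cos (Real.pi * x / 2) ^ 2 - 1 := by
    rw [← Real.cos_two_mul]; congr 1; ring
  have h2 := Real.sin_sq_add_cos_sq (Real.pi * x)
  have h3 := Real.sin_sq_add_cos_sq (Real.pi * x / 2)
  rw [mul_pow, sq_abs, sq_abs]
  nlinarith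

theorem woundFun_add_le (k : ℕ+) (x y : ℝ) :
    woundFun k (x + y) ≤ woundFun k x + woundFun k y := by
  have key : ∀ a b c d e f : ℝ, 0 ≤ e → 0 ≤ f → e ≤ a + c → f ≤ b + d →
      Real.sqrt (e ^ 2 + f ^ 2) ≤ Real.sqrt (a ^ 2 + b ^ 2) + Real.sqrt (c ^ 2 + d ^ 2) := by
    intro a b c d e f he hf h1 h2
    have h := norm_add_le (⟨a, b⟩ : ℂ) ⟨c, d⟩
    have hn : ∀ u v : ℝ, ‖(⟨u, v⟩ : ℂ)‖ = Real.sqrt (u ^ 2 + v ^ 2) := by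
      intro u v
      rw [Complex.norm_def, Complex.normSq_apply]
      congr 1
      ring
    have hadd : (⟨a, b⟩ : ℂ) + ⟨c, d⟩ = ⟨a + c, b + d⟩ := rfl
    rw [hadd, hn, hn, hn] at h
    refine le_trans (Real.sqrt_le_sqrt ?_) h
    gcongr
  rw [woundFun_eq, woundFun_eq, woundFun_eq]
  apply key
  · positivity
  · positivity
  · have : Real.pi * (x + y) / 2 = Real.pi * x / 2 + Real.pi * y / 2 := by ring
    rw [this, Real.sin_add]
    have h1 := abs_add_le (Real.sin (Real.pi * x / 2) * Real.cos (Real.pi * y / 2))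
      (Real.cos (Real.pi * x / 2) * Real.sin (Real.pi * y / 2))
    rw [abs_mul, abs_mul] at h1
    nlinarith [Real.abs_cos_le_one (Real.pi * x / 2), Real.abs_cos_le_one (Real.pi * y / 2),
      abs_nonneg (Real.sin (Real.pi * x / 2)), abs_nonneg (Real.sin (Real.pi * y / 2))]
  · rw [add_div]
    exact abs_add_le _ _

/-- The norm `|x|_k` on the `k`-th copy `H_k` of the group of reals. -/
noncomputable def woundNorm (k : ℕ+) : AddGroupNorm ℝ where
  toFun := woundFun k
  map_zero' := by simp [woundFun]
  add_le' := woundFun_add_le k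
  neg' x := by simp [woundFun, neg_div]
  eq_zero_of_map_eq_zero' x h := by
    rw [woundFun, Real.sqrt_eq_zero (by positivity)] at h
    have h0 : (x / 2 ^ ((k : ℕ) + 1)) ^ 2 = 0 := by
      nlinarith [sq_nonneg (Real.cos (Real.pi * x) - 1), sq_nonneg (Real.sin (Real.pi * x)),
        sq_nonneg (x / 2 ^ ((k : ℕ) + 1))]
    simpa using h0

/-- The direct sum of the groups `H_k = ℝ`, `k = 1, 2, …`. -/
def WoundSum : Type := ℕ+ →₀ ℝ

noncomputable instance : AddCommGroup WoundSum := inferInstanceAs (AddCommGroup (ℕ+ →₀ ℝ))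

/-- The norm `|(x_k)_k| = ∑_k |x_k|_k` on the direct sum (a finite sum over the support). -/
noncomputable def sumNorm : AddGroupNorm (ℕ+ →₀ ℝ) where
  toFun f := f.sum fun k x => woundNorm k x
  map_zero' := Finsupp.sum_zero_index
  add_le' f g := by
    classical
    have h : ∀ (u : ℕ+ →₀ ℝ), u.support ⊆ f.support ∪ g.support →
        (u.sum fun k x => woundNorm k x) = ∑ k ∈ f.support ∪ g.support, woundNorm k (u k) :=
      fun u hu => Finsupp.sum_of_support_subset u hu _ fun k _ => map_zero (woundNorm k)
    rw [h _ Finsupp.support_add, h _ Finset.subset_union_left, h _ Finset.subset_union_right,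
      ← Finset.sum_add_distrib]
    exact Finset.sum_le_sum fun k _ => map_add_le_add (woundNorm k) (f k) (g k)
  neg' f := by
    simp only [Finsupp.sum, Finsupp.support_neg, Finsupp.neg_apply, map_neg_eq_map]
  eq_zero_of_map_eq_zero' f h := by
    ext k
    by_cases hk : k ∈ f.support
    · have h' := (Finset.sum_eq_zero_iff_of_nonneg
        (fun i _ => apply_nonneg (woundNorm i) (f i))).1 h k hk
      exact eq_zero_of_map_eq_zero (woundNorm k) h'
    · simpa using hk

noncomputable instance : NormedAddCommGroup WoundSum :=
  @AddGroupNorm.toNormedAddCommGroup WoundSum inferInstance sumNorm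

/-- The group `H`: the completion of the direct sum with respect to its norm. -/
abbrev H : Type := UniformSpace.Completion WoundSum

end WoundGroup

open MeasureTheory Topology Filter Set

/-! In `H` the element `2` of `H_k` has norm `2 ^ (-k)`, since the line has wound once around its
cylinder, while its half `1` is on the opposite side, at distance at least `2` from the origin. So
halving is discontinuous. In a divisible torsion-free analytic `G`, doubling is a continuous
automorphism `e` of the abstract group. For continuous `f : H →+ G`, preimages of open and of closed
sets under `e⁻¹ ∘ f` are analytic, hence Borel by Suslin's theorem, and Pettis' lemma makes `e⁻¹ ∘
f` continuous. If `f` were an embedding, halving would be continuous on `2H`. -/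

/-- **Pettis' lemma**: the differences of a nonmeagre Borel set form a neighbourhood of zero. -/
theorem MeasurableSet.sub_mem_nhds_zero_of_not_isMeagre {X : Type*} [AddGroup X]
    [TopologicalSpace X] [IsTopologicalAddGroup X] [BaireSpace X] [MeasurableSpace X]
    [BorelSpace X] {s : Set X} (hs : MeasurableSet s) (hm : ¬ IsMeagre s) :
    {h : X | ∃ a ∈ s, ∃ b ∈ s, h = a - b} ∈ 𝓝 (0 : X) := by
  obtain ⟨u, hu, hsu⟩ := hs.residualEq_isOpen
  have hne : u.Nonempty := by
    rw [nonempty_iff_ne_empty]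
    rintro rfl
    exact hm (eventuallyEq_empty.1 hsu)
  obtain ⟨w, hw⟩ := hne
  have hcont : Tendsto (fun h : X => h + w) (𝓝 0) (𝓝 w) := by
    have : Continuous fun h : X => h + w := by fun_prop
    simpa using this.tendsto 0
  filter_upwards [hcont (hu.mem_nhds hw)] with h hh
  have htr : ∀ᶠ x in residual X, (h + x ∈ s) = (h + x ∈ u) :=
    (tendsto_residual_of_isOpenMap (Homeomorph.addLeft h).continuous
      (Homeomorph.addLeft h).isOpenMap).eventually hsu
  -- A comeagre set is dense, so it meets the open set `u ∩ (u - h)`, which contains `w`.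
  obtain ⟨x, ⟨hxu, hhu⟩, hx1, hx2⟩ := (dense_of_mem_residual (htr.and hsu)).inter_open_nonempty
    (u ∩ (fun x => h + x) ⁻¹' u) (hu.inter (hu.preimage (by fun_prop))) ⟨w, hw, hh⟩
  exact ⟨h + x, hx1.mpr hhu, x, hx2.mpr hxu, by simp⟩

/-- A Borel measurable homomorphism from a Baire topological group to a separable topological group
is continuous. -/
theorem AddMonoidHom.continuous_of_measurable_of_baireSpace {X G : Type*} [AddGroup X]
    [TopologicalSpace X] [IsTopologicalAddGroup X] [BaireSpace X] [MeasurableSpace X]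
    [BorelSpace X] [AddCommGroup G] [TopologicalSpace G] [IsTopologicalAddGroup G]
    [TopologicalSpace.SeparableSpace G] (φ : X →+ G)
    (hφ : ∀ U : Set G, IsOpen U → MeasurableSet (φ ⁻¹' U)) : Continuous φ := by
  refine continuous_of_continuousAt_zero φ ?_
  intro U hU
  rw [map_zero] at hU
  have hsub : Tendsto (fun p : G × G => p.1 - p.2) (𝓝 (0 : G) ×ˢ 𝓝 0) (𝓝 0) := by
    simpa [nhds_prod_eq] using (continuous_sub (G := G)).tendsto ((0 : G), (0 : G))
  obtain ⟨V, hV, hVU⟩ := mem_prod_self_iff.1 (hsub hU)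
  obtain ⟨W, hWV, hWo, hW0⟩ := mem_nhds_iff.1 hV
  let d := TopologicalSpace.denseSeq G
  -- Countably many translates of `W` cover `G`, so by Baire some preimage is nonmeagre; its
  -- differences map into `W - W ⊆ U`.
  have hopen : ∀ n, IsOpen ((fun g => g - d n) ⁻¹' W) := fun n => hWo.preimage (by fun_prop)
  have hcover : ⋃ n, φ ⁻¹' ((fun g => g - d n) ⁻¹' W) = univ := by
    refine eq_univ_of_forall fun x => ?_
    obtain ⟨y, hy, n, rfl⟩ := (TopologicalSpace.denseRange_denseSeq G).inter_open_nonempty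
      ((fun g => φ x - g) ⁻¹' W) (hWo.preimage (by fun_prop)) ⟨φ x, by simpa using hW0⟩
    exact mem_iUnion.2 ⟨n, hy⟩
  obtain ⟨n, hn⟩ : ∃ n, ¬ IsMeagre (φ ⁻¹' ((fun g => g - d n) ⁻¹' W)) := by
    by_contra! h
    have := isMeagre_iUnion h
    rw [hcover] at this
    exact not_isMeagre_of_mem_residual univ_mem this
  refine mem_map.2 (mem_of_superset ((hφ _ (hopen n)).sub_mem_nhds_zero_of_not_isMeagre hn) ?_)
  rintro _ ⟨a, ha, b, hb, rfl⟩
  have := hVU (show (φ a - d n, φ b - d n) ∈ V ×ˢ V from ⟨hWV ha, hWV hb⟩)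
  simpa using this

theorem MeasureTheory.AnalyticSet.of_isOpen_or_isClosed {G : Type*} [TopologicalSpace G]
    (hG : AnalyticSet (univ : Set G)) {U : Set G} (hU : IsOpen U ∨ IsClosed U) :
    AnalyticSet U := by
  obtain ⟨P, _, _, π, hπ, hr⟩ := analyticSet_iff_exists_polishSpace_range.1 hG
  have hs : Function.Surjective π := range_eq_univ.1 hr
  rw [← image_preimage_eq U hs]
  rcases hU with hU | hU
  · exact (hU.preimage hπ).analyticSet_image hπ
  · exact (hU.preimage hπ).analyticSet.image_of_continuous hπ

theorem MeasureTheory.AnalyticSet.separableSpace {G : Type*} [TopologicalSpace G]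
    (hG : AnalyticSet (univ : Set G)) : TopologicalSpace.SeparableSpace G := by
  obtain ⟨P, _, _, π, hπ, hr⟩ := analyticSet_iff_exists_polishSpace_range.1 hG
  exact (range_eq_univ.1 hr).denseRange.separableSpace hπ

/-- If `G` is analytic and `e` is a continuous automorphism of the abstract group `G`, then
composing a continuous homomorphism from a Polish group to `G` with the inverse of `e` gives a
continuous map. -/
theorem AddEquiv.continuous_symm_comp_of_analytic {X G : Type*} [AddGroup X]
    [TopologicalSpace X] [IsTopologicalAddGroup X] [PolishSpace X] [AddCommGroup G]
    [TopologicalSpace G] [IsTopologicalAddGroup G] [T2Space G] (hG : AnalyticSet (univ : Set G))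
    (e : G ≃+ G) (he : Continuous e) (f : X →+ G) (hf : Continuous f) :
    Continuous fun x => e.symm (f x) := by
  borelize X
  have := hG.separableSpace
  have key : ∀ U : Set G, AnalyticSet U → AnalyticSet ((fun x => e.symm (f x)) ⁻¹' U) := by
    intro U hU
    -- The preimage of `U` under `e⁻¹ ∘ f` is `f⁻¹(e(U))`, which involves only continuous maps.
    convert (hU.image_of_continuous he).preimage hf using 1
    ext x
    constructor
    · intro hx
      exact ⟨_, hx, by simp⟩
    · rintro ⟨u, hu, hux⟩
      simpa [← hux] using hu
  refine AddMonoidHom.continuous_of_measurable_of_baireSpace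
    (e.symm.toAddMonoidHom.comp f) fun U hU => ?_
  refine (key U (hG.of_isOpen_or_isClosed (.inl hU))).measurableSet_of_compl ?_
  exact key Uᶜ (hG.of_isOpen_or_isClosed (.inr hU.isClosed_compl))

namespace WoundGroup

/-! ### The norms on the summands and on the direct sum -/

theorem woundNorm_apply (k : ℕ+) (x : ℝ) : woundNorm k x = woundFun k x := rfl

theorem continuous_woundNorm (k : ℕ+) : Continuous (woundNorm k) := by
  change Continuous (woundFun k)
  unfold woundFun
  fun_prop

theorem abs_le_woundNorm (k : ℕ+) (x : ℝ) : |x| ≤ 2 ^ ((k : ℕ) + 1) * woundNorm k x := by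
  have h : |x / 2 ^ ((k : ℕ) + 1)| ≤ woundNorm k x := by
    rw [woundNorm_apply, woundFun, ← Real.sqrt_sq_eq_abs]
    refine Real.sqrt_le_sqrt (le_add_of_nonneg_left ?_)
    positivity
  rw [abs_div, abs_of_pos (by positivity : (0 : ℝ) < 2 ^ ((k : ℕ) + 1)),
    div_le_iff₀ (by positivity)] at h
  linarith

theorem woundNorm_two (k : ℕ+) : woundNorm k 2 = (1 / 2) ^ (k : ℕ) := by
  rw [woundNorm_apply, woundFun_eq]
  have h1 : Real.sin (Real.pi * 2 / 2) = 0 := by simp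
  rw [h1, show |(2 : ℝ) / 2 ^ ((k : ℕ) + 1)| = (1 / 2) ^ (k : ℕ) by
    rw [abs_of_pos (by positivity), pow_succ, one_div, inv_pow]; field_simp]
  simp

theorem two_le_woundNorm_one (k : ℕ+) : 2 ≤ woundNorm k 1 := by
  rw [woundNorm_apply, woundFun_eq]
  refine Real.le_sqrt_of_sq_le ?_
  have h1 : Real.sin (Real.pi * 1 / 2) = 1 := by simp
  rw [h1]
  norm_num

/-- The inclusion of the `k`-th summand. -/
noncomputable def single (k : ℕ+) : ℝ →+ WoundSum := Finsupp.singleAddHom k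

/-- The projection to the `k`-th summand. -/
noncomputable def coord (k : ℕ+) : WoundSum →+ ℝ := Finsupp.applyAddHom k

theorem norm_eq_sum {x : WoundSum} {F : Finset ℕ+} (h : ∀ k ∉ F, coord k x = 0) :
    ‖x‖ = ∑ k ∈ F, woundNorm k (coord k x) :=
  Finsupp.sum_of_support_subset (x : ℕ+ →₀ ℝ)
    (fun k hk => by
      by_contra hF
      exact Finsupp.mem_support_iff.1 hk (h k hF)) _ fun k _ => map_zero (woundNorm k)

theorem exists_finset_coord_eq_zero (x : WoundSum) : ∃ F : Finset ℕ+, ∀ k ∉ F, coord k x = 0 :=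
  ⟨Finsupp.support (x : ℕ+ →₀ ℝ), fun _ hk => Finsupp.notMem_support_iff.1 hk⟩

theorem sum_woundNorm_coord_le (x : WoundSum) (F : Finset ℕ+) :
    ∑ k ∈ F, woundNorm k (coord k x) ≤ ‖x‖ := by
  classical
  obtain ⟨F', hF'⟩ := exists_finset_coord_eq_zero x
  rw [norm_eq_sum (F := F ∪ F') fun k hk => hF' k fun h => hk (Finset.mem_union_right _ h)]
  exact Finset.sum_le_sum_of_subset_of_nonneg Finset.subset_union_left
    fun k _ _ => apply_nonneg (woundNorm k) _

theorem norm_single (k : ℕ+) (x : ℝ) : ‖single k x‖ = woundNorm k x :=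
  Finsupp.sum_single_index (map_zero (woundNorm k))

theorem continuous_single (k : ℕ+) : Continuous (single k) := by
  refine continuous_of_continuousAt_zero _ ?_
  rw [ContinuousAt, map_zero, tendsto_zero_iff_norm_tendsto_zero]
  simpa [norm_single] using (continuous_woundNorm k).tendsto 0

theorem continuous_coord (k : ℕ+) : Continuous (coord k) := by
  refine AddMonoidHomClass.continuous_of_bound (coord k) (2 ^ ((k : ℕ) + 1)) fun x => ?_
  refine (abs_le_woundNorm k _).trans ?_
  gcongr
  simpa using sum_woundNorm_coord_le x {k}

theorem eq_sum_single_coord {x : WoundSum} {F : Finset ℕ+} (h : ∀ k ∉ F, coord k x = 0) :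
    x = ∑ k ∈ F, single k (coord k x) := by
  have h0 : ‖x - ∑ k ∈ F, single k (coord k x)‖ = 0 := by
    have hc : ∀ j, coord j (x - ∑ k ∈ F, single k (coord k x)) = 0 := by
      classical
      intro j
      have hjk : ∀ k (t : ℝ), coord j (single k t) = if k = j then t else 0 :=
        fun k t => Finsupp.single_apply
      rw [map_sub, map_sum]
      simp only [hjk, Finset.sum_ite_eq']
      by_cases hj : j ∈ F
      · simp [hj]
      · simp [hj, h j hj]
    rw [norm_eq_sum (F := ∅) fun k _ => hc k, Finset.sum_empty]
  exact sub_eq_zero.1 (norm_eq_zero.1 h0)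

instance : TopologicalSpace.SeparableSpace WoundSum := by
  have hsep : TopologicalSpace.IsSeparable
      (⋃ F : Finset ℕ+, range fun v : ℕ+ → ℝ => ∑ k ∈ F, single k (v k)) := by
    refine TopologicalSpace.IsSeparable.iUnion fun F => TopologicalSpace.isSeparable_range ?_
    exact continuous_finsetSum _ fun k _ => (continuous_single k).comp (continuous_apply k)
  refine TopologicalSpace.isSeparable_univ_iff.1 (hsep.mono fun x _ => ?_)
  obtain ⟨F, hF⟩ := exists_finset_coord_eq_zero x
  exact mem_iUnion.2 ⟨F, fun k => coord k x, (eq_sum_single_coord hF).symm⟩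

/-! ### Coordinates on the completion -/

/-- The extension to `H` of the projection to the `k`-th summand. -/
noncomputable def coordH (k : ℕ+) : H →+ ℝ := (coord k).extension (continuous_coord k)

theorem coordH_coe (k : ℕ+) (x : WoundSum) : coordH k x = coord k x :=
  AddMonoidHom.extension_coe _ (continuous_coord k) x

theorem continuous_coordH (k : ℕ+) : Continuous (coordH k) :=
  AddMonoidHom.continuous_extension _ (continuous_coord k)

theorem sum_woundNorm_coordH_le (x : H) (F : Finset ℕ+) :
    ∑ k ∈ F, woundNorm k (coordH k x) ≤ ‖x‖ := by
  induction x using UniformSpace.Completion.induction_on with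
  | hp =>
    refine isClosed_le (continuous_finsetSum _ fun k _ => ?_) continuous_norm
    exact (continuous_woundNorm k).comp (continuous_coordH k)
  | ih x => simpa only [coordH_coe, UniformSpace.Completion.norm_coe] using
      sum_woundNorm_coord_le x F

/-- Let `y` be a finitely supported approximation of `x`. All coordinates of `y - x` are those of
`y`, so `‖y‖ ≤ ‖y - x‖` and `‖x‖ ≤ 2 * ‖x - y‖`. -/
theorem eq_zero_of_coordH_eq_zero {x : H} (h : ∀ k, coordH k x = 0) : x = 0 := by
  rw [← norm_le_zero_iff]
  refine le_of_forall_pos_le_add fun ε hε => ?_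
  obtain ⟨y, hy⟩ := (UniformSpace.Completion.denseRange_coe (α := WoundSum)).exists_dist_lt
    x (half_pos hε)
  obtain ⟨F, hF⟩ := exists_finset_coord_eq_zero y
  have h1 : ‖y‖ ≤ ‖(y : H) - x‖ := by
    rw [norm_eq_sum hF]
    simpa [map_sub, h, coordH_coe] using sum_woundNorm_coordH_le ((y : H) - x) F
  have h2 : ‖x‖ ≤ ‖x - (y : H)‖ + ‖(y : H)‖ := by simpa using norm_add_le (x - (y : H)) y
  rw [UniformSpace.Completion.norm_coe] at h2
  rw [norm_sub_rev] at h1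
  rw [dist_eq_norm] at hy
  linarith

/-- Completing can create torsion; here the coordinates embed `H` in a product of copies of `ℝ`. -/
instance : IsAddTorsionFree H where
  nsmul_right_injective n hn x y hxy := by
    rw [← sub_eq_zero]
    refine eq_zero_of_coordH_eq_zero fun k => ?_
    have h : n • coordH k x = n • coordH k y := by
      rw [← map_nsmul, ← map_nsmul]
      exact congrArg _ hxy
    rw [map_sub, sub_eq_zero]
    exact nsmul_right_injective hn h

/-! ### Halving -/

theorem two_nsmul_coe_single (k : ℕ+) :
    2 • ((single k 1 : WoundSum) : H) = (single k 2 : WoundSum) := by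
  rw [two_nsmul, ← UniformSpace.Completion.coe_add, ← map_add]
  norm_num

theorem tendsto_coe_single_two :
    Tendsto (fun n : ℕ => ((single n.succPNat 2 : WoundSum) : H)) atTop (𝓝 0) := by
  rw [tendsto_zero_iff_norm_tendsto_zero]
  simp only [UniformSpace.Completion.norm_coe, norm_single, woundNorm_two, Nat.succPNat_coe]
  exact (tendsto_pow_atTop_nhds_zero_of_lt_one (by norm_num) (by norm_num)).comp
    (tendsto_add_atTop_nat 1)

theorem not_tendsto_coe_single_one :
    ¬ Tendsto (fun n : ℕ => ((single n.succPNat 1 : WoundSum) : H)) atTop (𝓝 0) := by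
  rw [tendsto_zero_iff_norm_tendsto_zero]
  simp only [UniformSpace.Completion.norm_coe, norm_single]
  intro h
  have := ge_of_tendsto' h fun n => two_le_woundNorm_one n.succPNat
  norm_num at this

theorem not_continuous_divMap_two : ¬ Continuous (divMap H 2) := by
  intro hc
  let u : ℕ → multiples H 2 := fun n => ⟨(single n.succPNat 2 : WoundSum),
    (single n.succPNat 1 : WoundSum), two_nsmul_coe_single _⟩
  have hu : Tendsto u atTop (𝓝 0) := tendsto_subtype_rng.2 tendsto_coe_single_two
  have hd : ∀ n, divMap H 2 (u n) = (single n.succPNat 1 : WoundSum) := fun n =>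
    (divMap_eq_iff H 2 two_pos _ _).2 (two_nsmul_coe_single _)
  have h0 : divMap H 2 0 = 0 := (divMap_eq_iff H 2 two_pos _ _).2 (by simp)
  have h := (hc.tendsto 0).comp hu
  rw [h0] at h
  exact not_tendsto_coe_single_one (h.congr hd)

theorem not_exists_isEmbedding {G : Type*} [AddCommGroup G] [TopologicalSpace G]
    [IsTopologicalAddGroup G] (hG : IsAnalyticSpace G) (hdiv : IsDivisible G)
    [IsAddTorsionFree G] : ¬ ∃ f : H →+ G, IsEmbedding f := by
  rintro ⟨f, hf⟩
  have := hG.1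
  let e : G ≃+ G := AddEquiv.ofBijective (nsmulAddMonoidHom 2)
    ⟨nsmul_right_injective two_ne_zero, hdiv 2 two_pos⟩
  have he : ∀ g, e g = 2 • g := fun _ => rfl
  have hcont := e.continuous_symm_comp_of_analytic hG.2 (continuous_nsmul 2) f hf.continuous
  have h := (hcont.tendsto 0).comp tendsto_coe_single_two
  rw [map_zero, map_zero, ← map_zero f] at h
  -- An embedding reflects convergence, so the halves would tend to zero in `H`.
  refine not_tendsto_coe_single_one ((hf.tendsto_nhds_iff).2 (h.congr fun n => ?_))
  change e.symm (f _) = f _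
  rw [AddEquiv.symm_apply_eq, he, ← map_nsmul, two_nsmul_coe_single]

end WoundGroup

theorem mainTheorem7 :
    IsTopologicalAddGroup WoundGroup.H ∧ PolishSpace WoundGroup.H ∧
    IsAddTorsionFree WoundGroup.H ∧
    ¬ Continuous (WoundGroup.divMap WoundGroup.H 2) ∧
    ∀ (G : Type*) [AddCommGroup G] [TopologicalSpace G] [IsTopologicalAddGroup G],
      WoundGroup.IsAnalyticSpace G → WoundGroup.IsDivisible G → IsAddTorsionFree G →
        ¬ ∃ f : WoundGroup.H →+ G, Topology.IsEmbedding f :=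
  ⟨inferInstance, inferInstance, inferInstance, WoundGroup.not_continuous_divMap_two,
    fun _ _ _ _ hG hdiv _ => WoundGroup.not_exists_isEmbedding hG hdiv⟩
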